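/- Let $N\ge 1$ be an integer and let $w_0$ be a real- or complex-valued function on $[0,\infty)$ belonging to $L^1_{\mathrm{loc}}([0,\infty),t^{N-1}\,dt)$; that is, $w_0$ is measurable and $\int_0^a |w_0(t)|\,t^{N-1}\,dt<\infty$ for every $a>0$. Let $m_n$ denote Lebesgue measure on $\mathbb R^n$, $|\cdot|$ the Euclidean norm, and $B(z,R)=\{y\in\mathbb R^n:|z-y|<R\}$. Then for almost every $T>0$ the following holds: for all $s\ge 0$ and $R>0$ with $s^2+R^2=T^2$, and for every choice of points $z^n\in\mathbb R^n$ with $|z^n|=s$ $(n\ge N)$, the function $x\mapsto w_0(|x|)$ is integrable on $B(z^n,R)$ for every $n\ge N$, and $$\lim_{n\to\infty}\frac{1}{m_n(B(z^n,R))}\int_{B(z^n,R)} w_0(|x|)\,dm_n(x)=w_0(T).$$ The exceptional null set of values $T$ does not depend on $s$, $R$ or the points $z^n$. -/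

import Mathlib

open MeasureTheory Set Filter Topology

/-! In high dimension the mass of `B(z, R)` with `|z| = s` sits near the boundary sphere and near
the hyperplane through `z` orthogonal to `z`, where `|x|² ≈ s² + R² = T²`. So the law of `|x|` for a
uniform `x` in the ball concentrates at `T`, and the averages act as an approximate identity on `w₀`
at `T`.

Convergence at a Lebesgue point needs more than concentration: the radial densities must be
dominated by kernels decreasing in `|r - T|` with bounded mass, up to a vanishing constant. In
`ℝ^(n+1)`, for `s > 0`, the ball cuts the sphere of radius `r` in a cap `⟨z/s, ω⟩ > a/r` with `a =
(r² + s² - R²)/(2s)`. By `toSphere_cap_le` its contribution is governed by `(r² - a²)^(n/2)`, and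
`r² - a² = R² - (r² - T²)²/(4s²)` peaks at `r = T` with value `R²`. Together with
`volume_unitBall_le_succ` this gives a kernel of order `√n exp(-nB(r - T)²)`
(`radial_density_le_gaussian`). Where `a < s/4`, the crude bound `radial_density_le` is
exponentially small; for `s = 0` it suffices alone.

Densities are taken relative to `t^p dt`, `p = N - 1`, since only there is `w₀` known to be locally
integrable. The layer-cake argument of `tendsto_lintegral_antitone_comp_dist` then yields the limit
at every Lebesgue point `T > 0`, a condition not involving `s`, `R` or the centres. -/

/-! ### Polar coordinates -/

/-- Integration in polar coordinates: the measure of a set through its spherical slices. -/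
lemma measure_eq_lintegral_toSphere {E : Type*} [NormedAddCommGroup E] [NormedSpace ℝ E]
    [FiniteDimensional ℝ E] [Nontrivial E] [MeasurableSpace E] [BorelSpace E] (μ : Measure E)
    [μ.IsAddHaarMeasure] {S : Set E} (hS : MeasurableSet S) :
    μ S = ∫⁻ r in Ioi (0 : ℝ), ENNReal.ofReal (r ^ (Module.finrank ℝ E - 1)) *
      μ.toSphere {ω | r • (ω : E) ∈ S} := by
  set T : Set (Metric.sphere (0 : E) 1 × Ioi (0 : ℝ)) := {p | (p.2 : ℝ) • (p.1 : E) ∈ S}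
  have hT : MeasurableSet T := by
    refine measurableSet_preimage (f := fun p : Metric.sphere (0 : E) 1 × Ioi (0 : ℝ) =>
      (p.2 : ℝ) • (p.1 : E)) ?_ hS
    exact (Continuous.smul (by fun_prop) (by fun_prop)).measurable
  have h1 : μ S = (μ.comap (Subtype.val : ({0}ᶜ : Set E) → E)) (Subtype.val ⁻¹' S) := by
    rw [comap_subtype_coe_apply (measurableSet_singleton (0 : E)).compl,
      Subtype.image_preimage_coe, inter_comm, ← Measure.restrict_apply hS,
      restrict_compl_singleton]
  have h2 : (Subtype.val ⁻¹' S : Set ({0}ᶜ : Set E)) = homeomorphUnitSphereProd E ⁻¹' T := by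
    ext x
    have : (((homeomorphUnitSphereProd E x).2 : ℝ) • ((homeomorphUnitSphereProd E x).1 : E)) = x := by
      simp [smul_smul, mul_inv_cancel₀ (norm_ne_zero_iff.2 x.2)]
    simp only [mem_preimage, T, mem_ofPred_eq, this]
  rw [h1, h2, μ.measurePreserving_homeomorphUnitSphereProd.measure_preimage hT.nullMeasurableSet,
    Measure.prod_apply_symm hT, Measure.volumeIoiPow,
    lintegral_withDensity_eq_lintegral_mul _ (by fun_prop)
      (measurable_measure_prodMk_right hT),
    ← lintegral_subtype_comap measurableSet_Ioi]
  rfl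

/-! ### Cones, spherical caps and unit balls -/

/-- Inserting the factor `a / c ≥ 1` turns the integrand into an exact derivative. -/
lemma lintegral_sqrt_one_sub_sq_pow_le (n : ℕ) {c : ℝ} (hc : 0 < c) (hc1 : c < 1) :
    ∫⁻ a in Ioc c 1, ENNReal.ofReal (√(1 - a ^ 2) ^ n) ≤
      ENNReal.ofReal (√(1 - c ^ 2) ^ (n + 2) / ((n + 2) * c)) := by
  have hcont : ContinuousOn (fun a : ℝ => -(√(1 - a ^ 2) ^ (n + 2) / ((n + 2) * c))) (Icc c 1) := by
    fun_prop
  have hderiv : ∀ a ∈ Ioo c 1, HasDerivAt (fun a : ℝ => -(√(1 - a ^ 2) ^ (n + 2) / ((n + 2) * c)))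
      (a / c * √(1 - a ^ 2) ^ n) a := by
    intro a ha
    have hpos : 0 < 1 - a ^ 2 := by nlinarith [ha.1, ha.2]
    have h1 : HasDerivAt (fun a : ℝ => 1 - a ^ 2) (-(2 * a)) a := by
      simpa using (hasDerivAt_pow 2 a).const_sub 1
    have h2 := (((h1.sqrt hpos.ne').pow (n + 2)).div_const ((n + 2) * c)).neg
    convert! h2 using 1
    have hs : √(1 - a ^ 2) ≠ 0 := (Real.sqrt_pos.2 hpos).ne'
    have hn : ((n : ℝ) + 2) ≠ 0 := by positivity
    simp only [Nat.add_succ_sub_one, pow_succ, Nat.cast_add, Nat.cast_ofNat]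
    field_simp
  have hint : IntervalIntegrable (fun a : ℝ => a / c * √(1 - a ^ 2) ^ n) volume c 1 :=
    Continuous.intervalIntegrable (by fun_prop) _ _
  have hI := intervalIntegral.integral_eq_sub_of_hasDerivAt_of_le hc1.le hcont hderiv hint
  calc ∫⁻ a in Ioc c 1, ENNReal.ofReal (√(1 - a ^ 2) ^ n)
      ≤ ∫⁻ a in Ioc c 1, ENNReal.ofReal (a / c * √(1 - a ^ 2) ^ n) := by
        refine setLIntegral_mono' measurableSet_Ioc fun a ha => ENNReal.ofReal_le_ofReal ?_
        exact le_mul_of_one_le_left (by positivity) ((one_le_div hc).2 ha.1.le)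
    _ = ENNReal.ofReal (√(1 - c ^ 2) ^ (n + 2) / ((n + 2) * c)) := by
        rw [← ofReal_integral_eq_lintegral_ofReal, ← intervalIntegral.integral_of_le hc1.le, hI]
        · simp
        · exact hint.1
        · filter_upwards [ae_restrict_mem measurableSet_Ioc] with a ha
          have : 0 ≤ a := hc.le.trans ha.1.le
          positivity

lemma lintegral_mul_pow_le (n : ℕ) {c t : ℝ} (hc : 0 ≤ c) (ht : 0 ≤ t) :
    ∫⁻ a in Ioc 0 c, ENNReal.ofReal ((a * t) ^ n) =
      ENNReal.ofReal (t ^ n * c ^ (n + 1) / (n + 1)) := by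
  rw [← ofReal_integral_eq_lintegral_ofReal, ← intervalIntegral.integral_of_le hc]
  · simp only [mul_pow, intervalIntegral.integral_mul_const, integral_pow]
    congr 1
    rw [zero_pow (by omega)]
    ring
  · exact (Continuous.intervalIntegrable (by fun_prop) _ _).1
  · filter_upwards [ae_restrict_mem measurableSet_Ioc] with a ha
    have : 0 ≤ a := ha.1.le
    positivity

lemma volume_sum_sq_lt {n : ℕ} (hn : 1 ≤ n) {r : ℝ} (hr : 0 ≤ r) :
    volume {y : Fin n → ℝ | √(∑ i, y i ^ 2) < r} =
      ENNReal.ofReal (r ^ n) * volume (Metric.ball (0 : EuclideanSpace ℝ (Fin n)) 1) := by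
  have : Nonempty (Fin n) := ⟨⟨0, hn⟩⟩
  have h := (EuclideanSpace.volume_preserving_symm_measurableEquiv_toLp (Fin n)).symm.measure_preimage_equiv
    (Metric.ball (0 : EuclideanSpace ℝ (Fin n)) r)
  rw [Measure.addHaar_ball _ _ hr, finrank_euclideanSpace_fin] at h
  rw [← h]
  congr 1
  ext y
  simp [EuclideanSpace.norm_eq]

/-- The part of the unit ball lying in a circular cone has small volume. -/
lemma volume_cone_le {n : ℕ} (hn : 1 ≤ n) {c : ℝ} (hc : 0 < c) (hc1 : c < 1) :
    volume {x : EuclideanSpace ℝ (Fin (n + 1)) | ‖x‖ < 1 ∧ c * ‖x‖ < x 0} ≤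
      volume (Metric.ball (0 : EuclideanSpace ℝ (Fin n)) 1) *
        ENNReal.ofReal (√(1 - c ^ 2) ^ n / ((n + 1) * c)) := by
  set K : Set (ℝ × (Fin n → ℝ)) :=
    {p | √(p.1 ^ 2 + ∑ i, p.2 i ^ 2) < 1 ∧ c * √(p.1 ^ 2 + ∑ i, p.2 i ^ 2) < p.1}
  have hK : MeasurableSet K := by
    have hm : Measurable fun p : ℝ × (Fin n → ℝ) => √(p.1 ^ 2 + ∑ i, p.2 i ^ 2) := by fun_prop
    exact (measurableSet_lt hm measurable_const).inter
      (measurableSet_lt (hm.const_mul c) measurable_fst)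
  have hmp := (EuclideanSpace.volume_preserving_symm_measurableEquiv_toLp (Fin (n + 1))).trans
    (volume_preserving_piFinSuccAbove (fun _ : Fin (n + 1) => ℝ) 0)
  have h0 : volume {x : EuclideanSpace ℝ (Fin (n + 1)) | ‖x‖ < 1 ∧ c * ‖x‖ < x 0} = volume K := by
    rw [← hmp.measure_preimage_equiv K]
    congr 1
    ext x
    simp [K, EuclideanSpace.norm_eq, Fin.sum_univ_succ, MeasurableEquiv.piFinSuccAbove,
      Fin.tail]
  set ω := volume (Metric.ball (0 : EuclideanSpace ℝ (Fin n)) 1)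
  set q := √(1 - c ^ 2)
  have hq2 : q ^ 2 = 1 - c ^ 2 := Real.sq_sqrt (by nlinarith)
  -- Slices at height `a`: the cone bounds the radius by `a * q / c` when `a ≤ c`, the unit ball by
  -- `√(1 - a ^ 2)` when `c < a < 1`.
  have hq : 0 ≤ q := Real.sqrt_nonneg _
  have hslice : ∀ a : ℝ, volume (Prod.mk a ⁻¹' K) ≤
      (Ioc 0 c).indicator (fun a => ω * ENNReal.ofReal ((a * (q / c)) ^ n)) a +
      (Ioc c 1).indicator (fun a => ω * ENNReal.ofReal (√(1 - a ^ 2) ^ n)) a := by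
    intro a
    by_cases ha0 : 0 < a
    · by_cases hac : a ≤ c
      · rw [indicator_of_mem (show a ∈ Ioc 0 c from ⟨ha0, hac⟩)]
        refine le_add_right ?_
        rw [mul_comm, ← volume_sum_sq_lt hn (by positivity)]
        refine measure_mono fun y hy => ?_
        simp only [K, mem_preimage, mem_ofPred_eq] at hy ⊢
        have hS : 0 ≤ ∑ i, y i ^ 2 := by positivity
        rw [Real.sqrt_lt' (by
          have : 0 < q := Real.sqrt_pos.2 (by nlinarith)
          positivity), mul_pow, div_pow, hq2]
        have h2 := hy.2
        have h3 : (c * √(a ^ 2 + ∑ i, y i ^ 2)) ^ 2 < a ^ 2 := by gcongr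
        rw [mul_pow, Real.sq_sqrt (by positivity)] at h3
        rw [← mul_div_assoc, lt_div_iff₀ (by positivity)]
        linarith
      · push Not at hac
        by_cases ha1 : a < 1
        · rw [indicator_of_mem (show a ∈ Ioc c 1 from ⟨hac, ha1.le⟩)]
          refine le_add_left ?_
          rw [mul_comm, ← volume_sum_sq_lt hn (by positivity)]
          refine measure_mono fun y hy => ?_
          simp only [K, mem_preimage, mem_ofPred_eq] at hy ⊢
          have h1 := hy.1
          rw [Real.sqrt_lt' one_pos] at h1
          apply Real.sqrt_lt_sqrt (by positivity)
          linarith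
        · have : Prod.mk a ⁻¹' K = ∅ := by
            ext y
            simp only [K, mem_preimage, mem_ofPred_eq, mem_empty_iff_false, iff_false]
            intro h
            have h1 := h.1
            rw [Real.sqrt_lt' one_pos] at h1
            have hS : 0 ≤ ∑ i, y i ^ 2 := by positivity
            nlinarith
          simp [this]
    · have : Prod.mk a ⁻¹' K = ∅ := by
        ext y
        simp only [K, mem_preimage, mem_ofPred_eq, mem_empty_iff_false, iff_false]
        intro h
        have := h.2
        have h3 : 0 ≤ c * √(a ^ 2 + ∑ i, y i ^ 2) := by positivity
        linarith
      simp [this]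
  rw [h0, Measure.volume_eq_prod, Measure.prod_apply hK]
  refine (lintegral_mono hslice).trans ?_
  rw [lintegral_add_left ((by fun_prop : Measurable fun a : ℝ =>
      ω * ENNReal.ofReal ((a * (q / c)) ^ n)).indicator measurableSet_Ioc),
    lintegral_indicator measurableSet_Ioc, lintegral_indicator measurableSet_Ioc,
    lintegral_const_mul _ (by fun_prop), lintegral_const_mul _ (by fun_prop), ← mul_add]
  gcongr
  rw [lintegral_mul_pow_le n hc.le (by positivity)]
  grw [lintegral_sqrt_one_sub_sq_pow_le n hc hc1]
  rw [← ENNReal.ofReal_add (by positivity) (by positivity)]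
  apply ENNReal.ofReal_le_ofReal
  change (q / c) ^ n * c ^ (n + 1) / (n + 1) + q ^ (n + 2) / ((n + 2) * c) ≤ _
  have h1 : (q / c) ^ n * c ^ (n + 1) / (n + 1) = q ^ n * c ^ 2 / ((n + 1) * c) := by
    rw [div_pow]
    field_simp
    ring
  -- Weakening `n + 2` to `n + 1` lets the two terms combine through `q ^ 2 + c ^ 2 = 1`.
  have h2 : q ^ (n + 2) / ((n + 2) * c) ≤ q ^ (n + 2) / ((n + 1) * c) := by
    gcongr; norm_num
  have h3 : q ^ n * c ^ 2 / ((n + 1) * c) + q ^ (n + 2) / ((n + 1) * c) =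
      q ^ n / ((n + 1) * c) := by
    rw [pow_add, hq2, ← add_div]
    ring_nf
  linarith

open scoped Pointwise in
/-- A bound for the surface measure of a spherical cap. -/
lemma toSphere_cap_le {n : ℕ} (hn : 1 ≤ n) {c : ℝ} (hc : 0 < c)
    {e : EuclideanSpace ℝ (Fin (n + 1))} (he : ‖e‖ = 1) :
    (volume : Measure (EuclideanSpace ℝ (Fin (n + 1)))).toSphere
        {ω | c < inner ℝ e (ω : EuclideanSpace ℝ (Fin (n + 1)))} ≤
      volume (Metric.ball (0 : EuclideanSpace ℝ (Fin n)) 1) *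
        ENNReal.ofReal (√(1 - c ^ 2) ^ n / c) := by
  by_cases hc1 : c < 1
  swap
  · have : {ω : Metric.sphere (0 : EuclideanSpace ℝ (Fin (n + 1))) 1 |
        c < inner ℝ e (ω : EuclideanSpace ℝ (Fin (n + 1)))} = ∅ := by
      ext ω
      simp only [mem_ofPred_eq, mem_empty_iff_false, iff_false, not_lt]
      have := real_inner_le_norm e (ω : EuclideanSpace ℝ (Fin (n + 1)))
      rw [he, norm_eq_of_mem_sphere] at this
      linarith
    simp [this]
  have hmeas : MeasurableSet {ω : Metric.sphere (0 : EuclideanSpace ℝ (Fin (n + 1))) 1 |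
      c < inner ℝ e (ω : EuclideanSpace ℝ (Fin (n + 1)))} :=
    measurableSet_lt (by fun_prop) (by fun_prop)
  -- Surface measure is `n + 1` times the volume of the cone over the cap, which cancels the `n + 1`
  -- of `volume_cone_le`. A reflection carries the first basis vector to `e`.
  rw [Measure.toSphere_apply' _ hmeas, finrank_euclideanSpace_fin]
  set e₀ : EuclideanSpace ℝ (Fin (n + 1)) := EuclideanSpace.single 0 1
  set L := (Submodule.span ℝ {e₀ - e})ᗮ.reflection
  have hL : L e₀ = e := Submodule.reflection_sub (by simp [he, e₀])
  have hsub : Ioo (0 : ℝ) 1 • (Subtype.val '' {ω : Metric.sphere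
      (0 : EuclideanSpace ℝ (Fin (n + 1))) 1 |
        c < inner ℝ e (ω : EuclideanSpace ℝ (Fin (n + 1)))}) ⊆
      L.symm ⁻¹' {x : EuclideanSpace ℝ (Fin (n + 1)) | ‖x‖ < 1 ∧ c * ‖x‖ < x 0} := by
    rintro _ ⟨r, hr, _, ⟨ω, hω, rfl⟩, rfl⟩
    have hnorm : ‖r • (ω : EuclideanSpace ℝ (Fin (n + 1)))‖ = r := by
      rw [norm_smul, norm_eq_of_mem_sphere, mul_one, Real.norm_of_nonneg hr.1.le]
    have hin : (L.symm (r • (ω : EuclideanSpace ℝ (Fin (n + 1))))) 0 =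
        r * inner ℝ e (ω : EuclideanSpace ℝ (Fin (n + 1))) := by
      rw [← hL, ← real_inner_smul_right, ← L.symm.inner_map_map, L.symm_apply_apply]
      simp [e₀, EuclideanSpace.inner_single_left]
    simp only [mem_preimage, mem_ofPred_eq, LinearIsometryEquiv.norm_map, hnorm, hin]
    refine ⟨hr.2, ?_⟩
    rw [mul_comm]
    exact mul_lt_mul_of_pos_left hω hr.1
  grw [hsub]
  rw [L.symm.measurePreserving.measure_preimage_emb
    L.symm.toHomeomorph.measurableEmbedding]
  grw [volume_cone_le hn hc hc1]
  rw [mul_left_comm, ← ENNReal.ofReal_natCast, ← ENNReal.ofReal_mul (by positivity)]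
  apply le_of_eq
  congr 2
  push_cast
  field_simp

/-- The volumes of the unit balls in consecutive dimensions are comparable. -/
lemma volume_unitBall_le_succ {n : ℕ} (hn : 1 ≤ n) :
    volume (Metric.ball (0 : EuclideanSpace ℝ (Fin n)) 1) ≤
      ENNReal.ofReal √(n + 1) *
        volume (Metric.ball (0 : EuclideanSpace ℝ (Fin (n + 1))) 1) := by
  have : Nonempty (Fin n) := ⟨⟨0, hn⟩⟩
  rw [EuclideanSpace.volume_ball, EuclideanSpace.volume_ball]
  simp only [ENNReal.ofReal_one, one_pow, one_mul, Fintype.card_fin]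
  rw [← ENNReal.ofReal_mul (by positivity)]
  apply ENNReal.ofReal_le_ofReal
  set x : ℝ := n / 2 + 1 with hx
  have hx0 : 0 < x := by positivity
  have e1 : ((n + 1 : ℕ) : ℝ) / 2 + 1 = x + 1 / 2 := by push_cast; ring
  rw [e1]
  -- Log-convexity of `Gamma` at the midpoint of `x` and `x + 1`.
  have hG : Real.Gamma (x + 1 / 2) ≤ √x * Real.Gamma x := by
    have h := Real.Gamma_mul_add_mul_le_rpow_Gamma_mul_rpow_Gamma (s := x) (t := x + 1)
      (a := 1 / 2) (b := 1 / 2) hx0 (by positivity) (by norm_num) (by norm_num) (by norm_num)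
    rw [← Real.sqrt_eq_rpow, ← Real.sqrt_eq_rpow, Real.Gamma_add_one hx0.ne',
      Real.sqrt_mul hx0.le, mul_left_comm,
      Real.mul_self_sqrt (Real.Gamma_pos_of_pos hx0).le] at h
    convert h using 2
    ring
  have hGx := Real.Gamma_pos_of_pos hx0
  have hGy : 0 < Real.Gamma (x + 1 / 2) := Real.Gamma_pos_of_pos (by positivity)
  have hxle : √x ≤ √(n + 1) * √Real.pi := by
    rw [← Real.sqrt_mul (by positivity)]
    apply Real.sqrt_le_sqrt
    have h3 := Real.pi_gt_three
    have : (0 : ℝ) ≤ n := by positivity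
    nlinarith
  rw [← mul_div_assoc, div_le_div_iff₀ hGx hGy, pow_succ]
  calc √Real.pi ^ n * Real.Gamma (x + 1 / 2) ≤ √Real.pi ^ n * ((√(n + 1) * √Real.pi) * Real.Gamma x) := by
        gcongr
        exact hG.trans (by gcongr)
    _ = _ := by ring

/-! ### Symmetrically decreasing kernels at a point of density zero -/

/-- If `ν` gives to small balls around `T` at most `ε` times their length, the same comparison
holds for the integrals over such a ball of symmetrically decreasing functions. -/
lemma setLIntegral_antitone_comp_dist_le {ν : Measure ℝ} (hac : ν ≪ volume) {T δ : ℝ}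
    {ε : ENNReal}
    (hν : ∀ τ, 0 < τ → τ ≤ δ → ν (Metric.closedBall T τ) ≤ ε * volume (Metric.closedBall T τ))
    {k : ℝ → ℝ} (hk : AntitoneOn k (Ici 0)) (hk0 : ∀ t, 0 ≤ k t) (hkm : Measurable k) :
    ∫⁻ r in Metric.closedBall T δ, ENNReal.ofReal (k |r - T|) ∂ν ≤
      ε * ∫⁻ r, ENNReal.ofReal (k |r - T|) := by
  have hm : Measurable fun r : ℝ => k |r - T| := hkm.comp (by fun_prop)
  refine le_trans ?_ (mul_le_mul_right (setLIntegral_le_lintegral (Metric.closedBall T δ) _) ε)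
  -- Layer cake: it is enough to compare the two measures on each superlevel set. Such a set lies
  -- between the open and the closed ball of radius `τ`, which have equal length.
  rw [lintegral_eq_lintegral_meas_lt _ (ae_of_all _ fun r => hk0 _) hm.aemeasurable,
    lintegral_eq_lintegral_meas_lt _ (ae_of_all _ fun r => hk0 _) hm.aemeasurable]
  have hmeas : ∀ l : ℝ, MeasurableSet {r | l < k |r - T|} := fun l =>
    measurableSet_lt measurable_const hm
  rw [← lintegral_const_mul]
  swap
  · exact Antitone.measurable fun a b hab => measure_mono fun r hr => lt_of_le_of_lt hab hr
  refine lintegral_mono fun l => ?_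
  simp only
  rw [Measure.restrict_apply (hmeas l), Measure.restrict_apply (hmeas l)]
  set S : Set ℝ := {r | l < k |r - T|} ∩ Metric.closedBall T δ with hS
  rcases S.eq_empty_or_nonempty with hemp | hne
  · simp [hemp]
  set D : Set ℝ := (fun r => |r - T|) '' S
  have hDne : D.Nonempty := hne.image _
  have hDb : ∀ d ∈ D, d ≤ δ := by
    rintro _ ⟨r, hr, rfl⟩
    simpa [Real.dist_eq] using hr.2
  have hbdd : BddAbove D := ⟨δ, hDb⟩
  set τ := sSup D
  have hτδ : τ ≤ δ := csSup_le hDne hDb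
  have hsub : S ⊆ Metric.closedBall T τ := fun r hr => by
    simpa [Real.dist_eq] using le_csSup hbdd (mem_image_of_mem _ hr)
  have hsup : Metric.ball T τ ⊆ S := fun r hr => by
    rw [Metric.mem_ball, Real.dist_eq] at hr
    obtain ⟨_, ⟨r', hr', rfl⟩, hlt⟩ := exists_lt_of_lt_csSup hDne hr
    refine ⟨lt_of_lt_of_le hr'.1 (hk (abs_nonneg (r - T)) (abs_nonneg (r' - T)) hlt.le), ?_⟩
    rw [Metric.mem_closedBall, Real.dist_eq]
    exact hr.le.trans hτδ
  rcases le_or_gt τ 0 with h0 | h0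
  · have : volume (Metric.closedBall T τ) = 0 := by
      rw [Real.volume_closedBall]; simpa using h0
    rw [hac (measure_mono_null hsub this)]
    exact zero_le
  · calc ν S ≤ ν (Metric.closedBall T τ) := measure_mono hsub
      _ ≤ ε * volume (Metric.closedBall T τ) := hν τ h0 hτδ
      _ = ε * volume (Metric.ball T τ) := by rw [Real.volume_closedBall, Real.volume_ball]
      _ ≤ ε * volume S := by gcongr

/-- Kernels that decrease with the distance from `T`, have bounded mass and concentrate at `T`
have vanishing integrals against a finite measure of density zero at `T`. -/
lemma tendsto_lintegral_antitone_comp_dist {ν : Measure ℝ} [IsFiniteMeasure ν]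
    (hac : ν ≪ volume) {T : ℝ}
    (hν : Tendsto (fun τ => ν (Metric.closedBall T τ) / volume (Metric.closedBall T τ))
      (𝓝[>] 0) (𝓝 0))
    {k : ℕ → ℝ → ℝ} (hk : ∀ n, AntitoneOn (k n) (Ici 0)) (hk0 : ∀ n t, 0 ≤ k n t)
    (hkm : ∀ n, Measurable (k n)) {C : ENNReal} (hC : C ≠ ⊤)
    (hint : ∀ᶠ n in atTop, ∫⁻ r, ENNReal.ofReal (k n |r - T|) ≤ C)
    (hlim : ∀ δ, 0 < δ → Tendsto (fun n => k n δ) atTop (𝓝 0)) :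
    Tendsto (fun n => ∫⁻ r, ENNReal.ofReal (k n |r - T|) ∂ν) atTop (𝓝 0) := by
  rw [ENNReal.tendsto_nhds_zero]
  intro ε hε
  -- `η` is the density allowed near `T`, where the kernels have mass at most `C`; away from `T` the
  -- kernel is at most `k n δ`.
  obtain ⟨η, hη0, hη⟩ : ∃ η : ENNReal, 0 < η ∧ η * C ≤ ε / 2 := by
    have hlim : Tendsto (fun η : ENNReal => η * C) (𝓝[>] 0) (𝓝 (0 * C)) :=
      (ENNReal.Tendsto.mul_const tendsto_id (Or.inr hC)).mono_left nhdsWithin_le_nhds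
    rw [zero_mul, ENNReal.tendsto_nhds_zero] at hlim
    have := (hlim (ε / 2) (ENNReal.half_pos hε.ne')).and self_mem_nhdsWithin
    obtain ⟨η, h1, h2⟩ := this.exists
    exact ⟨η, h2, h1⟩
  rw [ENNReal.tendsto_nhds_zero] at hν
  obtain ⟨δ, hδ0, hδ⟩ := mem_nhdsGT_iff_exists_Ioc_subset.1 (hν η hη0)
  have hδ0' : (0 : ℝ) < δ := hδ0
  have hball : ∀ τ, 0 < τ → τ ≤ δ →
      ν (Metric.closedBall T τ) ≤ η * volume (Metric.closedBall T τ) := by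
    intro τ h0 h1
    have := hδ ⟨h0, h1⟩
    simp only [mem_ofPred_eq] at this
    rwa [ENNReal.div_le_iff] at this
    · rw [Real.volume_closedBall]; simpa using h0
    · rw [Real.volume_closedBall]; exact ENNReal.ofReal_ne_top
  have hfar : Tendsto (fun n => ENNReal.ofReal (k n δ) * ν univ) atTop (𝓝 0) := by
    have := ENNReal.Tendsto.mul_const (ENNReal.tendsto_ofReal (hlim δ hδ0'))
      (Or.inr (measure_ne_top ν univ))
    simpa using this
  rw [ENNReal.tendsto_nhds_zero] at hfar
  filter_upwards [hint, hfar (ε / 2) (ENNReal.half_pos hε.ne')] with n h1 h2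
  rw [← lintegral_add_compl _ (Metric.isClosed_closedBall (x := T) (ε := δ)).measurableSet,
    ← ENNReal.add_halves ε]
  gcongr
  · calc _ ≤ η * ∫⁻ r, ENNReal.ofReal (k n |r - T|) :=
          setLIntegral_antitone_comp_dist_le hac hball (hk n) (hk0 n) (hkm n)
      _ ≤ η * C := by gcongr
      _ ≤ ε / 2 := hη
  · calc _ ≤ ∫⁻ r in (Metric.closedBall T δ)ᶜ, ENNReal.ofReal (k n δ) ∂ν := by
          refine setLIntegral_mono' (Metric.isClosed_closedBall).measurableSet.compl fun r hr => ?_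
          apply ENNReal.ofReal_le_ofReal
          rw [mem_compl_iff, Metric.mem_closedBall, Real.dist_eq, not_le] at hr
          exact hk n hδ0'.le (abs_nonneg (r - T)) hr.le
      _ ≤ ENNReal.ofReal (k n δ) * ν univ := by
          rw [setLIntegral_const]
          gcongr
          exact subset_univ _
      _ ≤ ε / 2 := h2

/-! ### Radial densities relative to `t ^ p dt` -/

/-- The measure `t ^ p dt` on `[0, ∞)`. -/
noncomputable def powMeasure (p : ℕ) : Measure ℝ :=
  ((volume : Measure ℝ).withDensity (fun t => ENNReal.ofReal (t ^ p))).restrict (Ici (0 : ℝ))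

instance (p : ℕ) : IsLocallyFiniteMeasure (powMeasure p) := by
  have : IsLocallyFiniteMeasure
      ((volume : Measure ℝ).withDensity (fun t => ENNReal.ofReal (t ^ p))) :=
    IsLocallyFiniteMeasure.withDensity_ofReal (by fun_prop)
  unfold powMeasure
  infer_instance

lemma powMeasure_absolutelyContinuous (p : ℕ) : powMeasure p ≪ volume :=
  Measure.restrict_le_self.absolutelyContinuous.trans (withDensity_absolutelyContinuous _ _)

lemma restrict_Ioi_absolutelyContinuous_powMeasure (p : ℕ) :
    (volume : Measure ℝ).restrict (Ioi 0) ≪ powMeasure p := by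
  have h1 : (volume : Measure ℝ).restrict (Ioi 0) ≪
      ((volume : Measure ℝ).restrict (Ioi 0)).withDensity (fun t => ENNReal.ofReal (t ^ p)) := by
    apply withDensity_absolutelyContinuous' (by fun_prop)
    filter_upwards [ae_restrict_mem measurableSet_Ioi] with t ht
    have : 0 < t ^ p := pow_pos ht p
    simpa using this
  refine h1.trans ?_
  rw [← restrict_withDensity measurableSet_Ioi]
  exact (Measure.restrict_mono Ioi_subset_Ici_self le_rfl).absolutelyContinuous

/-- A pointwise bound on the radial density of Lebesgue measure on a ball bounds its image under
the norm. -/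
lemma map_norm_restrict_ball_le {n p : ℕ} {s R : ℝ} {z : EuclideanSpace ℝ (Fin (n + 1))}
    (hz : ‖z‖ = s) {κ : ℝ → ENNReal} (hκ : Measurable κ)
    (h : ∀ r ∈ Ioo 0 (s + R), ENNReal.ofReal (r ^ n) *
      (volume : Measure (EuclideanSpace ℝ (Fin (n + 1)))).toSphere
        {ω | r • (ω : EuclideanSpace ℝ (Fin (n + 1))) ∈ Metric.ball z R} ≤
      volume (Metric.ball z R) * (ENNReal.ofReal (r ^ p) * κ r)) :
    (volume.restrict (Metric.ball z R)).map norm ≤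
      volume (Metric.ball z R) • ((powMeasure p).restrict (Iio (s + R))).withDensity κ := by
  refine Measure.le_iff.2 fun A hA => ?_
  rw [Measure.map_apply measurable_norm hA, Measure.restrict_apply (measurable_norm hA),
    measure_eq_lintegral_toSphere _ ((measurable_norm hA).inter measurableSet_ball),
    finrank_euclideanSpace_fin, Nat.add_sub_cancel, Measure.smul_apply, smul_eq_mul,
    withDensity_apply _ hA, Measure.restrict_restrict hA, powMeasure,
    Measure.restrict_restrict (hA.inter measurableSet_Iio),
    setLIntegral_withDensity_eq_setLIntegral_mul _ (by fun_prop) hκ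
      ((hA.inter measurableSet_Iio).inter measurableSet_Ici),
    ← lintegral_const_mul _ (by fun_prop)]
  calc _ ≤ ∫⁻ r in Ioi 0, (A ∩ Iio (s + R)).indicator
        (fun r => volume (Metric.ball z R) * (ENNReal.ofReal (r ^ p) * κ r)) r := by
        refine setLIntegral_mono' measurableSet_Ioi fun r hr => ?_
        have hr0 : 0 < r := hr
        by_cases hrA : r ∈ A ∩ Iio (s + R)
        · rw [indicator_of_mem hrA]
          exact le_trans (mul_le_mul_right (measure_mono fun ω hω => hω.2) _) (h r ⟨hr, hrA.2⟩)
        · have : {ω : Metric.sphere (0 : EuclideanSpace ℝ (Fin (n + 1))) 1 |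
              r • (ω : EuclideanSpace ℝ (Fin (n + 1))) ∈
                norm ⁻¹' A ∩ Metric.ball z R} = ∅ := by
            ext ω
            simp only [mem_ofPred_eq, mem_empty_iff_false, iff_false]
            rintro ⟨h1, h2⟩
            have hn : ‖r • (ω : EuclideanSpace ℝ (Fin (n + 1)))‖ = r := by
              rw [norm_smul, norm_eq_of_mem_sphere, mul_one, Real.norm_of_nonneg hr0.le]
            rw [mem_preimage, hn] at h1
            refine hrA ⟨h1, ?_⟩
            rw [mem_ball_iff_norm] at h2
            have := norm_sub_norm_le (r • (ω : EuclideanSpace ℝ (Fin (n + 1)))) z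
            rw [hn, hz] at this
            rw [mem_Iio]
            linarith
          rw [this]
          simp
    _ = ∫⁻ r in (A ∩ Iio (s + R)) ∩ Ioi 0,
          volume (Metric.ball z R) * (ENNReal.ofReal (r ^ p) * κ r) := by
        rw [lintegral_indicator (hA.inter measurableSet_Iio),
          Measure.restrict_restrict (hA.inter measurableSet_Iio)]
    _ ≤ _ := lintegral_mono_set (inter_subset_inter_right _ Ioi_subset_Ici_self)

lemma volume_ball_eq_pow_mul_unitBall {n : ℕ} (z : EuclideanSpace ℝ (Fin (n + 1))) {R : ℝ}
    (hR : 0 ≤ R) : volume (Metric.ball z R) = ENNReal.ofReal (R ^ (n + 1)) *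
      volume (Metric.ball (0 : EuclideanSpace ℝ (Fin (n + 1))) 1) := by
  rw [Measure.addHaar_ball _ _ hR, finrank_euclideanSpace_fin]

/-- The radial density of a ball is at most that of the full space. -/
lemma radial_density_le {n p : ℕ} (hp : p ≤ n) {R r : ℝ} (hR : 0 < R) (hr : 0 < r)
    (z : EuclideanSpace ℝ (Fin (n + 1))) :
    ENNReal.ofReal (r ^ n) * (volume : Measure (EuclideanSpace ℝ (Fin (n + 1)))).toSphere
        {ω | r • (ω : EuclideanSpace ℝ (Fin (n + 1))) ∈ Metric.ball z R} ≤
      volume (Metric.ball z R) * (ENNReal.ofReal (r ^ p) *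
        ENNReal.ofReal ((n + 1) / R ^ (p + 1) * (r / R) ^ (n - p))) := by
  grw [measure_mono (subset_univ _)]
  rw [Measure.toSphere_apply_univ, finrank_euclideanSpace_fin,
    volume_ball_eq_pow_mul_unitBall z hR.le, ← ENNReal.ofReal_natCast (n + 1),
    mul_right_comm (ENNReal.ofReal (R ^ (n + 1))), ← mul_assoc]
  refine mul_le_mul_left ?_ _
  rw [← ENNReal.ofReal_mul (by positivity), ← ENNReal.ofReal_mul (by positivity),
    ← ENNReal.ofReal_mul (by positivity)]
  apply ENNReal.ofReal_le_ofReal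
  apply le_of_eq
  obtain ⟨j, rfl⟩ := Nat.exists_eq_add_of_le hp
  simp only [Nat.add_sub_cancel_left]
  push_cast
  rw [div_pow]
  field_simp
  ring

/-- Expanding `‖r • ω - z‖ ^ 2 < R ^ 2` places `ω` in a cap about `z / s`. -/
lemma inner_normalized_of_smul_mem_ball {n : ℕ} {s R r : ℝ} (hs : 0 < s) (hr : 0 < r)
    {z : EuclideanSpace ℝ (Fin (n + 1))} (hz : ‖z‖ = s)
    {ω : EuclideanSpace ℝ (Fin (n + 1))} (hω : ‖ω‖ = 1) (h : r • ω ∈ Metric.ball z R) :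
    (r ^ 2 + s ^ 2 - R ^ 2) / (2 * s) / r < inner ℝ (s⁻¹ • z) ω := by
  rw [mem_ball_iff_norm] at h
  have h1 : ‖r • ω - z‖ ^ 2 < R ^ 2 := by gcongr
  rw [norm_sub_sq_real, norm_smul, hω, hz, real_inner_smul_left, mul_one,
    Real.norm_of_nonneg hr.le, real_inner_comm] at h1
  rw [real_inner_smul_left, div_div, div_lt_iff₀ (by positivity)]
  field_simp
  linarith

/-- The Gaussian bound for the radial density of an off-centre ball. -/
lemma radial_density_le_gaussian {n p : ℕ} (hn : 1 ≤ n) {s R T r : ℝ} (hs : 0 < s) (hR : 0 < R)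
    (hT : 0 < T) (hsRT : s ^ 2 + R ^ 2 = T ^ 2) (hr : 0 < r) (hrM : r < s + R)
    (hrs : s / 4 ≤ (r ^ 2 + s ^ 2 - R ^ 2) / (2 * s))
    {z : EuclideanSpace ℝ (Fin (n + 1))} (hz : ‖z‖ = s) :
    ENNReal.ofReal (r ^ n) * (volume : Measure (EuclideanSpace ℝ (Fin (n + 1)))).toSphere
        {ω | r • (ω : EuclideanSpace ℝ (Fin (n + 1))) ∈ Metric.ball z R} ≤
      volume (Metric.ball z R) * (ENNReal.ofReal (r ^ p) *
        ENNReal.ofReal (4 * (s + R) / (s * R) * (4 / s) ^ p * (√(n + 1) *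
          Real.exp (-(n * (T ^ 2 / (8 * s ^ 2 * R ^ 2))) * |r - T| ^ 2)))) := by
  set a := (r ^ 2 + s ^ 2 - R ^ 2) / (2 * s) with ha
  have ha0 : 0 < a := by linarith
  have hsub : {ω : Metric.sphere (0 : EuclideanSpace ℝ (Fin (n + 1))) 1 |
      r • (ω : EuclideanSpace ℝ (Fin (n + 1))) ∈ Metric.ball z R} ⊆
      {ω | a / r < inner ℝ (s⁻¹ • z) (ω : EuclideanSpace ℝ (Fin (n + 1)))} := fun ω hω =>
    inner_normalized_of_smul_mem_ball hs hr hz (norm_eq_of_mem_sphere ω) hω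
  grw [hsub, toSphere_cap_le hn (by positivity)
    (by rw [norm_smul, hz, norm_inv, Real.norm_of_nonneg hs.le, inv_mul_cancel₀ hs.ne']),
    volume_unitBall_le_succ hn]
  rw [volume_ball_eq_pow_mul_unitBall z hR.le]
  set U := volume (Metric.ball (0 : EuclideanSpace ℝ (Fin (n + 1))) 1)
  rw [mul_right_comm _ U, ← mul_assoc, mul_right_comm _ U, mul_left_comm, mul_comm _ U, mul_comm _ U]
  refine mul_le_mul_right ?_ _
  rw [← ENNReal.ofReal_mul (by positivity), ← ENNReal.ofReal_mul (by positivity),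
    ← ENNReal.ofReal_mul (by positivity), ← ENNReal.ofReal_mul (by positivity)]
  apply ENNReal.ofReal_le_ofReal
  -- For `r ≤ a` the cap bound is zero: `√` vanishes on nonpositive reals, and `n ≥ 1` keeps its
  -- power zero.
  rcases le_or_gt r a with har | har
  · have : √(1 - (a / r) ^ 2) = 0 := by
      apply Real.sqrt_eq_zero_of_nonpos
      have : 1 ≤ a / r := (one_le_div hr).2 har
      nlinarith
    rw [this, zero_pow (by omega)]
    simp only [zero_div, mul_zero]
    positivity
  -- From `1 - y ≤ exp (-y)` and `(r + T) ^ 2 ≥ T ^ 2`; the square root halves the exponent, turning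
  -- 4 into 8.
  have hq : r * √(1 - (a / r) ^ 2) ≤
      R * Real.exp (-(T ^ 2 / (8 * s ^ 2 * R ^ 2)) * |r - T| ^ 2) := by
    have e1 : r * √(1 - (a / r) ^ 2) = √(R ^ 2 - (r ^ 2 - T ^ 2) ^ 2 / (4 * s ^ 2)) := by
      rw [← Real.sqrt_sq hr.le, ← Real.sqrt_mul (by positivity), Real.sqrt_sq hr.le]
      congr 1
      rw [ha, ← hsRT]
      field_simp
      ring
    rw [e1]
    apply Real.sqrt_le_iff.2 ⟨by positivity, ?_⟩
    rw [mul_pow, ← Real.exp_nat_mul, sq_abs]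
    set y := (r ^ 2 - T ^ 2) ^ 2 / (4 * s ^ 2 * R ^ 2)
    have hy : T ^ 2 * (r - T) ^ 2 / (4 * s ^ 2 * R ^ 2) ≤ y := by
      apply div_le_div_of_nonneg_right _ (by positivity)
      have : (r ^ 2 - T ^ 2) ^ 2 = (r + T) ^ 2 * (r - T) ^ 2 := by ring
      rw [this]
      gcongr
      linarith
    have h1 := Real.add_one_le_exp (-y)
    calc R ^ 2 - (r ^ 2 - T ^ 2) ^ 2 / (4 * s ^ 2) = R ^ 2 * (-y + 1) := by
          simp only [y]; field_simp; ring
      _ ≤ R ^ 2 * Real.exp (-y) := by gcongr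
      _ ≤ _ := by
          gcongr
          refine le_trans (neg_le_neg hy) (le_of_eq ?_)
          push_cast
          field_simp
          ring
  have hpow : r ^ n * √(1 - (a / r) ^ 2) ^ n ≤
      R ^ n * Real.exp (-(n * (T ^ 2 / (8 * s ^ 2 * R ^ 2))) * |r - T| ^ 2) := by
    rw [← mul_pow]
    calc _ ≤ (R * Real.exp (-(T ^ 2 / (8 * s ^ 2 * R ^ 2)) * |r - T| ^ 2)) ^ n := by gcongr
      _ = _ := by
        rw [mul_pow, ← Real.exp_nat_mul]
        congr 2
        ring
  have hra : r / a ≤ 4 * (s + R) / s := by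
    rw [div_le_div_iff₀ ha0 hs]
    nlinarith
  -- Here `r > a ≥ s / 4`, so the weight `r ^ p` can be inserted at bounded cost.
  have hone : 1 ≤ r ^ p * (4 / s) ^ p := by
    rw [← mul_pow]
    apply one_le_pow₀
    rw [← mul_div_assoc, one_le_div hs]
    linarith
  calc √(n + 1) * (r ^ n * (√(1 - (a / r) ^ 2) ^ n / (a / r)))
      = √(n + 1) * (r ^ n * √(1 - (a / r) ^ 2) ^ n) * (r / a) * 1 := by
        field_simp
    _ ≤ √(n + 1) * (R ^ n * Real.exp (-(n * (T ^ 2 / (8 * s ^ 2 * R ^ 2))) * |r - T| ^ 2)) *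
        (4 * (s + R) / s) * (r ^ p * (4 / s) ^ p) := by gcongr
    _ = _ := by
        rw [pow_succ R n]
        field_simp

/-! ### Concentrating kernels -/

lemma tendsto_succ_mul_pow_sub {q : ℝ} (hq : 0 ≤ q) (hq1 : q < 1) (p : ℕ) :
    Tendsto (fun n : ℕ => ((n : ℝ) + 1) * q ^ (n - p)) atTop (𝓝 0) := by
  rw [← tendsto_add_atTop_iff_nat p]
  simp only [Nat.add_sub_cancel]
  have h1 := tendsto_self_mul_const_pow_of_lt_one hq hq1
  have h2 := (tendsto_pow_atTop_nhds_zero_of_lt_one hq hq1).const_mul ((p : ℝ) + 1)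
  convert h1.add h2 using 2
  · push_cast; ring
  · simp

lemma lintegral_gaussian_dist {A b : ℝ} (hA : 0 ≤ A) (hb : 0 < b) (T : ℝ) :
    ∫⁻ r, ENNReal.ofReal (A * Real.exp (-b * |r - T| ^ 2)) = ENNReal.ofReal (A * √(Real.pi / b)) := by
  simp only [sq_abs]
  rw [lintegral_sub_right_eq_self (fun r => ENNReal.ofReal (A * Real.exp (-b * r ^ 2))) T,
    ← ofReal_integral_eq_lintegral_ofReal ((integrable_exp_neg_mul_sq hb).const_mul A)
      (ae_of_all _ fun r => by positivity), integral_const_mul, integral_gaussian]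

lemma lintegral_exp_neg_dist {A b : ℝ} (hA : 0 ≤ A) (hb : 0 < b) (T : ℝ) :
    ∫⁻ r, ENNReal.ofReal (A * Real.exp (-b * |r - T|)) = ENNReal.ofReal (A * (2 / b)) := by
  rw [lintegral_sub_right_eq_self (fun r => ENNReal.ofReal (A * Real.exp (-b * |r|))) T]
  have hval : ∫ r, Real.exp (-b * |r|) = 2 / b := by
    rw [integral_comp_abs (f := fun r => Real.exp (-b * r)), integral_exp_mul_Ioi (by linarith)]
    simp
    field_simp
  have habs : Integrable fun r => Real.exp (-b * |r|) :=
    Integrable.of_integral_ne_zero (by rw [hval]; positivity)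
  rw [← ofReal_integral_eq_lintegral_ofReal (habs.const_mul A)
      (ae_of_all _ fun r => by positivity), integral_const_mul, hval]

/-- The norm of a uniform random point of an off-centre ball, in dimension tending to infinity, has
a density dominated by kernels concentrating at `T = √(‖z‖² + R²)`. -/
lemma exists_concentrating_kernel_of_pos (p : ℕ) {s R T : ℝ} (hs : 0 < s) (hR : 0 < R) (hT : 0 < T)
    (hsRT : s ^ 2 + R ^ 2 = T ^ 2) :
    ∃ κ : ℕ → ℝ → ENNReal, (∀ n, Measurable (κ n)) ∧
      (∀ᶠ n in atTop, ∀ z : EuclideanSpace ℝ (Fin (n + 1)), ‖z‖ = s →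
        (volume.restrict (Metric.ball z R)).map norm ≤
          volume (Metric.ball z R) • ((powMeasure p).restrict (Iio (s + R))).withDensity (κ n)) ∧
      ∀ ν : Measure ℝ, IsFiniteMeasure ν → ν ≪ volume →
        Tendsto (fun τ => ν (Metric.closedBall T τ) / volume (Metric.closedBall T τ))
          (𝓝[>] 0) (𝓝 0) →
        Tendsto (fun n => ∫⁻ r, κ n r ∂ν) atTop (𝓝 0) := by
  set A := 4 * (s + R) / (s * R) * (4 / s) ^ p
  set B := T ^ 2 / (8 * s ^ 2 * R ^ 2)
  have hA : 0 < A := by positivity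
  have hB : 0 < B := by positivity
  -- The zone without the Gaussian bound, `a < s / 4`, is `r ^ 2 < R ^ 2 - s ^ 2 / 2`, that is `r <
  -- q * R`. There the crude density is at most the constant `b n`.
  set q := √(1 - s ^ 2 / (2 * R ^ 2))
  have hq0 : 0 ≤ q := Real.sqrt_nonneg _
  have hq1 : q < 1 := by
    rw [Real.sqrt_lt' one_pos]
    have : 0 < s ^ 2 / (2 * R ^ 2) := by positivity
    linarith
  set k : ℕ → ℝ → ℝ := fun n t => A * (√(n + 1) * Real.exp (-(n * B) * t ^ 2))
  set b : ℕ → ℝ := fun n => (n + 1) / R ^ (p + 1) * q ^ (n - p)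
  have hkm : ∀ n, Measurable (k n) := fun n => by fun_prop
  refine ⟨fun n r => ENNReal.ofReal (k n |r - T|) + ENNReal.ofReal (b n), ?_, ?_, ?_⟩
  · exact fun n => by fun_prop
  · filter_upwards [eventually_ge_atTop p, eventually_ge_atTop 1] with n hn hn1 z hz
    refine map_norm_restrict_ball_le hz (by fun_prop) fun r hr => ?_
    rcases le_or_gt (s / 4) ((r ^ 2 + s ^ 2 - R ^ 2) / (2 * s)) with h | h
    · refine (radial_density_le_gaussian (p := p) hn1 hs hR hT hsRT hr.1 hr.2 h hz).trans ?_
      gcongr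
      exact le_self_add
    · refine (radial_density_le hn hR hr.1 z).trans ?_
      gcongr
      refine le_trans ?_ le_add_self
      have hr0 := hr.1
      have : r / R ≤ q := by
        apply Real.le_sqrt_of_sq_le
        rw [div_lt_div_iff₀ (by positivity) (by positivity)] at h
        rw [div_pow, div_le_iff₀ (by positivity)]
        field_simp
        nlinarith
      simp only [b]
      gcongr
  · intro ν hν hac hdens
    have hk : Tendsto (fun n => ∫⁻ r, ENNReal.ofReal (k n |r - T|) ∂ν) atTop (𝓝 0) := by
      refine tendsto_lintegral_antitone_comp_dist hac hdens ?_ (fun n t => by positivity) hkm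
        -- The Gaussian mass is `A * √((n + 1) * π / (n * B))`, and `n + 1 ≤ 2 * n`.
        (C := ENNReal.ofReal (A * √(2 * Real.pi / B))) ENNReal.ofReal_ne_top ?_ ?_
      · intro n x hx y hy hxy
        have hx0 : 0 ≤ x := hx
        simp only [k, neg_mul]
        gcongr
      · filter_upwards [eventually_ge_atTop 1] with n hn
        have hn' : (1 : ℝ) ≤ n := by exact_mod_cast hn
        simp only [k, ← mul_assoc A]
        rw [lintegral_gaussian_dist (by positivity) (by positivity)]
        apply ENNReal.ofReal_le_ofReal
        rw [mul_assoc, ← Real.sqrt_mul (by positivity)]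
        gcongr
        rw [← mul_div_assoc, div_le_div_iff₀ (by positivity) hB]
        have : ((n : ℝ) + 1) ≤ 2 * n := by linarith
        calc ((n : ℝ) + 1) * Real.pi * B ≤ (2 * n) * Real.pi * B := by gcongr
          _ = _ := by ring
      · intro δ hδ
        have h0 : Real.exp (-(B * δ ^ 2)) < 1 := by
          rw [Real.exp_lt_one_iff]
          have : 0 < B * δ ^ 2 := by positivity
          linarith
        have h1 := (tendsto_succ_mul_pow_sub (Real.exp_nonneg _) h0 0).const_mul A
        rw [mul_zero] at h1
        refine squeeze_zero (fun n => by positivity) (fun n => ?_) h1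
        simp only [k, Nat.sub_zero, ← Real.exp_nat_mul]
        rw [show -(n * B) * δ ^ 2 = n * -(B * δ ^ 2) by ring]
        gcongr
        rw [Real.sqrt_le_left (by positivity)]
        have : (0 : ℝ) ≤ n := by positivity
        nlinarith
    have hb : Tendsto (fun n => ENNReal.ofReal (b n) * ν univ) atTop (𝓝 0) := by
      have h1 : Tendsto b atTop (𝓝 0) := by
        have := (tendsto_succ_mul_pow_sub hq0 hq1 p).div_const (R ^ (p + 1))
        rw [zero_div] at this
        refine this.congr fun n => ?_
        simp only [b]
        ring
      simpa using ENNReal.Tendsto.mul_const (ENNReal.tendsto_ofReal h1)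
        (Or.inr (measure_ne_top ν univ))
    refine (by simpa using hk.add hb : Tendsto _ _ _).congr fun n => ?_
    rw [lintegral_add_right _ measurable_const, lintegral_const]

/-- The norm of a uniform random point of a centred ball, in dimension tending to infinity, has
a density dominated by kernels concentrating at the radius. -/
lemma exists_concentrating_kernel_zero (p : ℕ) {R : ℝ} (hR : 0 < R) :
    ∃ κ : ℕ → ℝ → ENNReal, (∀ n, Measurable (κ n)) ∧
      (∀ᶠ n in atTop, ∀ z : EuclideanSpace ℝ (Fin (n + 1)), ‖z‖ = 0 →
        (volume.restrict (Metric.ball z R)).map norm ≤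
          volume (Metric.ball z R) • ((powMeasure p).restrict (Iio (0 + R))).withDensity (κ n)) ∧
      ∀ ν : Measure ℝ, IsFiniteMeasure ν → ν ≪ volume →
        Tendsto (fun τ => ν (Metric.closedBall R τ) / volume (Metric.closedBall R τ))
          (𝓝[>] 0) (𝓝 0) →
        Tendsto (fun n => ∫⁻ r, κ n r ∂ν) atTop (𝓝 0) := by
  set k : ℕ → ℝ → ℝ := fun n t => (n + 1) / R ^ (p + 1) * Real.exp (-((n - p : ℕ) / R) * t)
  have hkm : ∀ n, Measurable (k n) := fun n => by fun_prop
  refine ⟨fun n r => ENNReal.ofReal (k n |r - R|), fun n => by fun_prop, ?_, ?_⟩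
  · filter_upwards [eventually_ge_atTop p] with n hn z hz
    refine map_norm_restrict_ball_le hz (by fun_prop) fun r hr => ?_
    refine (radial_density_le hn hR hr.1 z).trans ?_
    have hr0 := hr.1
    have hrR : r < R := by simpa using hr.2
    simp only [k]
    gcongr
    -- This is `1 - x ≤ exp (-x)` with `x = |r - R| / R`.
    have h1 : r / R ≤ Real.exp (-|r - R| / R) := by
      have h2 := Real.add_one_le_exp (-|r - R| / R)
      refine le_trans (le_of_eq ?_) h2
      rw [abs_of_neg (by linarith)]
      field_simp
      ring
    calc (r / R) ^ (n - p) ≤ Real.exp (-|r - R| / R) ^ (n - p) := by gcongr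
      _ = _ := by
        rw [← Real.exp_nat_mul]
        congr 1
        ring
  · intro ν hν hac hdens
    refine tendsto_lintegral_antitone_comp_dist hac hdens ?_ (fun n t => by positivity) hkm
        -- The mass is `(n + 1) / R ^ (p + 1) * (2 * R / (n - p))`, and `(n + 1) / (n - p) ≤ p + 2`
        -- once `n > p`.
        (C := ENNReal.ofReal ((p + 2) / R ^ (p + 1) * (2 * R))) ENNReal.ofReal_ne_top ?_ ?_
    · intro n x hx y hy hxy
      simp only [k, neg_mul]
      gcongr
    · filter_upwards [eventually_ge_atTop (p + 1)] with n hn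
      obtain ⟨j, rfl⟩ := Nat.exists_eq_add_of_le hn
      have hj : p + 1 + j - p = j + 1 := by omega
      simp only [k, hj]
      rw [lintegral_exp_neg_dist (by positivity) (by positivity)]
      apply ENNReal.ofReal_le_ofReal
      push_cast
      rw [show (2 : ℝ) / ((j + 1) / R) = 2 * R / (j + 1) by field_simp, div_mul_div_comm,
        div_mul_eq_mul_div, div_le_div_iff₀ (by positivity) (by positivity)]
      have : ((p : ℝ) + 1 + j + 1) ≤ (p + 2) * (j + 1) := by
        have : (0 : ℝ) ≤ p * j := by positivity
        nlinarith [(Nat.cast_nonneg j : (0 : ℝ) ≤ j)]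
      calc _ = ((p : ℝ) + 1 + j + 1) * (2 * R * R ^ (p + 1)) := by ring
        _ ≤ ((p + 2) * (j + 1)) * (2 * R * R ^ (p + 1)) := by gcongr
        _ = _ := by ring
    · intro δ hδ
      have h0 : Real.exp (-(δ / R)) < 1 := by
        rw [Real.exp_lt_one_iff]
        have : 0 < δ / R := by positivity
        linarith
      have h1 := (tendsto_succ_mul_pow_sub (Real.exp_nonneg _) h0 p).div_const (R ^ (p + 1))
      rw [zero_div] at h1
      refine h1.congr fun n => ?_
      simp only [k, ← Real.exp_nat_mul]
      rw [div_mul_eq_mul_div]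
      congr 3
      ring

lemma exists_concentrating_kernel (p : ℕ) {s R T : ℝ} (hs : 0 ≤ s) (hR : 0 < R) (hT : 0 < T)
    (hsRT : s ^ 2 + R ^ 2 = T ^ 2) :
    ∃ κ : ℕ → ℝ → ENNReal, (∀ n, Measurable (κ n)) ∧
      (∀ᶠ n in atTop, ∀ z : EuclideanSpace ℝ (Fin (n + 1)), ‖z‖ = s →
        (volume.restrict (Metric.ball z R)).map norm ≤
          volume (Metric.ball z R) • ((powMeasure p).restrict (Iio (s + R))).withDensity (κ n)) ∧
      ∀ ν : Measure ℝ, IsFiniteMeasure ν → ν ≪ volume →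
        Tendsto (fun τ => ν (Metric.closedBall T τ) / volume (Metric.closedBall T τ))
          (𝓝[>] 0) (𝓝 0) →
        Tendsto (fun n => ∫⁻ r, κ n r ∂ν) atTop (𝓝 0) := by
  rcases hs.eq_or_lt with rfl | hs
  · obtain rfl : R = T := by
      have h : R ^ 2 = T ^ 2 := by linarith
      exact (pow_left_inj₀ hR.le hT.le two_ne_zero).1 h
    exact exists_concentrating_kernel_zero p hR
  · exact exists_concentrating_kernel_of_pos p hs hR hT hsRT

/-! ### Lebesgue points -/

lemma powMeasure_closedBall_le (p : ℕ) {T τ : ℝ} (hT : 0 < T) (hτ : τ ≤ 1) :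
    powMeasure p (Metric.closedBall T τ) ≤
      ENNReal.ofReal ((T + 1) ^ p) * volume (Metric.closedBall T τ) := by
  have hm : MeasurableSet (Metric.closedBall T τ) := Metric.isClosed_closedBall.measurableSet
  grw [powMeasure, Measure.restrict_le_self]
  rw [withDensity_apply _ hm, ← setLIntegral_const]
  refine setLIntegral_mono' hm fun t ht => ENNReal.ofReal_le_ofReal ?_
  rw [Metric.mem_closedBall, Real.dist_eq, abs_le] at ht
  calc t ^ p ≤ |t| ^ p := by rw [← abs_pow]; exact le_abs_self _
    _ ≤ (T + 1) ^ p := by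
      gcongr
      rw [abs_le]
      constructor <;> linarith

/-- Lebesgue differentiation for functions that are locally integrable for `t ^ p dt`. -/
lemma ae_tendsto_powMeasure_lintegral_enorm_sub_div {E : Type*} [NormedAddCommGroup E] {p : ℕ}
    {w : ℝ → E} (hw : LocallyIntegrable w (powMeasure p)) :
    ∀ᵐ T ∂((volume : Measure ℝ).restrict (Ioi (0 : ℝ))),
      Tendsto (fun τ => (∫⁻ y in Metric.closedBall T τ, ‖w y - w T‖ₑ ∂(powMeasure p)) /
        volume (Metric.closedBall T τ)) (𝓝[>] 0) (𝓝 0) := by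
  have h := (restrict_Ioi_absolutelyContinuous_powMeasure p).ae_le
    ((Besicovitch.vitaliFamily (powMeasure p)).ae_tendsto_lintegral_enorm_sub_div hw)
  filter_upwards [h, ae_restrict_mem measurableSet_Ioi] with T hT hT0
  have hT0' : 0 < T := hT0
  -- The differentiation theorem normalises by `powMeasure p`; for `τ ≤ 1` passing to length costs
  -- at most the factor `(T + 1) ^ p`.
  have h1 := ENNReal.Tendsto.mul_const (b := ENNReal.ofReal ((T + 1) ^ p))
    (hT.comp (Besicovitch.tendsto_filterAt (powMeasure p) T)) (Or.inr ENNReal.ofReal_ne_top)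
  rw [zero_mul] at h1
  refine tendsto_of_tendsto_of_tendsto_of_le_of_le' tendsto_const_nhds h1
    (Eventually.of_forall fun _ => zero_le) ?_
  filter_upwards [Ioc_mem_nhdsGT (zero_lt_one' ℝ)] with τ hτ
  simp only [Function.comp_apply]
  apply ENNReal.div_le_of_le_mul
  rcases eq_or_ne (powMeasure p (Metric.closedBall T τ)) 0 with h0 | h0
  · rw [setLIntegral_measure_zero _ _ h0]
    exact zero_le
  · rw [mul_assoc]
    grw [← powMeasure_closedBall_le p hT0' hτ.2]
    rw [ENNReal.div_mul_cancel h0 (isCompact_closedBall T τ).measure_lt_top.ne]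

lemma integrable_restrict_Iio_powMeasure {E : Type*} [NormedAddCommGroup E] {p : ℕ}
    {w : ℝ → E} (hw : LocallyIntegrable w (powMeasure p)) (M : ℝ) :
    Integrable w ((powMeasure p).restrict (Iio M)) := by
  have h := hw.integrableOn_isCompact (isCompact_Icc (a := (0 : ℝ)) (b := M))
  rw [IntegrableOn, powMeasure, Measure.restrict_restrict measurableSet_Icc] at h
  rw [powMeasure, Measure.restrict_restrict measurableSet_Iio]
  refine h.mono_measure (Measure.restrict_mono ?_ le_rfl)
  exact fun t ht => ⟨⟨ht.2, le_of_lt ht.1⟩, ht.2⟩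

/-! ### Averages over balls -/

/-- In a centred ball containing the given one, the polar weight `t ^ n` is `t ^ p` times the
bounded factor `t ^ (n - p)`. -/
lemma integrableOn_comp_norm_ball {E : Type*} [NormedAddCommGroup E] [NormedSpace ℝ E] {n p : ℕ}
    (hp : p ≤ n) {w : ℝ → E} (hw : LocallyIntegrable w (powMeasure p))
    (z : EuclideanSpace ℝ (Fin (n + 1))) (R : ℝ) :
    IntegrableOn (fun x : EuclideanSpace ℝ (Fin (n + 1)) => w ‖x‖) (Metric.ball z R) volume := by
  have h0 : IntegrableOn (fun x : EuclideanSpace ℝ (Fin (n + 1)) => w ‖x‖)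
      (Metric.ball 0 (R + ‖z‖)) volume := by
    rw [integrableOn_fun_norm_addHaar, finrank_euclideanSpace_fin, Nat.add_sub_cancel]
    have h := integrable_restrict_Iio_powMeasure hw (R + ‖z‖)
    rw [powMeasure, Measure.restrict_restrict measurableSet_Iio] at h
    have h1 : IntegrableOn w (Ioo 0 (R + ‖z‖))
        ((volume : Measure ℝ).withDensity (fun t => ENNReal.ofReal (t ^ p))) :=
      h.mono_measure (Measure.restrict_mono
        (show Ioo 0 (R + ‖z‖) ⊆ Iio (R + ‖z‖) ∩ Ici 0 from fun t ht => ⟨ht.2, ht.1.le⟩) le_rfl)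
    rw [IntegrableOn, restrict_withDensity measurableSet_Ioo,
      integrable_withDensity_iff_integrable_smul' (by fun_prop)
        (ae_of_all _ fun _ => ENNReal.ofReal_lt_top)] at h1
    have h2 := IntegrableOn.continuousOn_smul_of_subset (f := fun t : ℝ => t ^ (n - p))
      (K := Icc 0 (R + ‖z‖)) (by fun_prop) h1 isCompact_Icc measurableSet_Ioo Ioo_subset_Icc_self
    refine h2.congr_fun (fun t ht => ?_) measurableSet_Ioo
    have ht0 : 0 < t := ht.1
    simp only
    rw [ENNReal.toReal_ofReal (by positivity), smul_smul, ← pow_add, Nat.sub_add_cancel hp]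
  exact h0.mono_set (Metric.ball_subset_ball' (by simp))

lemma enorm_setAverage_sub_le {α E : Type*} [MeasurableSpace α] [NormedAddCommGroup E]
    [NormedSpace ℝ E] [CompleteSpace E] {μ : Measure α} {B : Set α} (h0 : μ B ≠ 0) (h1 : μ B ≠ ⊤)
    {f : α → E} (hf : IntegrableOn f B μ) (c : E) :
    ‖(⨍ x in B, f x ∂μ) - c‖ₑ ≤ (μ B)⁻¹ * ∫⁻ x in B, ‖f x - c‖ₑ ∂μ := by
  have : NeZero (μ.restrict B) := ⟨by simpa using h0⟩
  have : IsFiniteMeasure (μ.restrict B) := ⟨by simpa using h1.lt_top⟩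
  have hfi : Integrable f (((μ.restrict B) univ)⁻¹ • μ.restrict B) := hf.to_average
  have hc : ∫ _, c ∂(((μ.restrict B) univ)⁻¹ • μ.restrict B) = c := by
    rw [integral_const, probReal_univ, one_smul]
  rw [average, ← Measure.restrict_apply_univ B, ← smul_eq_mul, ← lintegral_smul_measure]
  have hsub := integral_sub hfi (integrable_const c)
  rw [hc] at hsub
  rw [← hsub]
  exact enorm_integral_le_lintegral_enorm _

lemma tendsto_setAverage_comp_norm_ball {E : Type*} [NormedAddCommGroup E] [NormedSpace ℝ E]
    [CompleteSpace E] {p : ℕ} {w : ℝ → E} (hw : LocallyIntegrable w (powMeasure p))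
    {s R T : ℝ} (hs : 0 ≤ s) (hR : 0 < R) (hT : 0 < T) (hsRT : s ^ 2 + R ^ 2 = T ^ 2)
    (hleb : Tendsto (fun τ => (∫⁻ y in Metric.closedBall T τ, ‖w y - w T‖ₑ ∂(powMeasure p)) /
        volume (Metric.closedBall T τ)) (𝓝[>] 0) (𝓝 0))
    {z : (n : ℕ) → EuclideanSpace ℝ (Fin (n + 1))} (hz : ∀ᶠ n in atTop, ‖z n‖ = s) :
    Tendsto (fun n => ⨍ x in Metric.ball (z n) R, w ‖x‖ ∂volume) atTop (𝓝 (w T)) := by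
  obtain ⟨κ, hκm, hκ, hlim⟩ := exists_concentrating_kernel p hs hR hT hsRT
  set m := (powMeasure p).restrict (Iio (s + R)) with hm
  have : IsFiniteMeasure m := by
    refine ⟨?_⟩
    have := integrable_restrict_Iio_powMeasure
      (continuous_const (y := (1 : ℝ)).locallyIntegrable (μ := powMeasure p)) (s + R)
    rw [integrable_const_iff] at this
    simpa [hm, isFiniteMeasure_iff] using this
  have hwm : Integrable (fun r => w r - w T) m :=
    (integrable_restrict_Iio_powMeasure hw (s + R)).sub (integrable_const _)
  have hdm : AEMeasurable (fun r => ‖w r - w T‖ₑ) m := hwm.1.enorm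
  -- The Lebesgue-point condition says that `ν` has density zero at `T`; the error of the average is
  -- eventually at most `∫⁻ r, κ n r ∂ν`.
  set ν := m.withDensity fun r => ‖w r - w T‖ₑ
  have hν : Tendsto (fun n => ∫⁻ r, κ n r ∂ν) atTop (𝓝 0) := by
    refine hlim ν (isFiniteMeasure_withDensity hwm.2.ne) ?_ ?_
    · exact (withDensity_absolutelyContinuous _ _).trans
        (Measure.restrict_le_self.absolutelyContinuous.trans (powMeasure_absolutelyContinuous p))
    · refine tendsto_of_tendsto_of_tendsto_of_le_of_le tendsto_const_nhds hleb
        (fun _ => zero_le) fun τ => ?_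
      simp only [ν]
      rw [withDensity_apply _ Metric.isClosed_closedBall.measurableSet]
      gcongr
      exact Measure.restrict_le_self
  rw [tendsto_iff_edist_tendsto_0]
  refine tendsto_of_tendsto_of_tendsto_of_le_of_le' tendsto_const_nhds hν
    (Eventually.of_forall fun _ => zero_le) ?_
  filter_upwards [hκ, hz, eventually_ge_atTop p] with n hn hzn hpn
  have h0 : volume (Metric.ball (z n) R) ≠ 0 := (Metric.measure_ball_pos _ _ hR).ne'
  have h1 : volume (Metric.ball (z n) R) ≠ ⊤ := measure_ball_lt_top.ne
  rw [edist_eq_enorm_sub]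
  refine (enorm_setAverage_sub_le h0 h1 (integrableOn_comp_norm_ball hpn hw (z n) R) (w T)).trans ?_
  have hle := hn (z n) hzn
  -- `w` is only a.e. measurable for `m`, so the change of variables to the norm needs this absolute
  -- continuity.
  have hac : (volume.restrict (Metric.ball (z n) R)).map norm ≪ m :=
    hle.absolutelyContinuous.trans ((Measure.AbsolutelyContinuous.smul_left
      (withDensity_absolutelyContinuous m (κ n)) _))
  rw [← lintegral_map' (hdm.mono_ac hac) measurable_norm.aemeasurable]
  grw [lintegral_mono' hle le_rfl]
  rw [lintegral_smul_measure, smul_eq_mul, ← mul_assoc, ENNReal.inv_mul_cancel h0 h1, one_mul,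
    lintegral_withDensity_eq_lintegral_mul₀ (hκm n).aemeasurable hdm,
    lintegral_withDensity_eq_lintegral_mul₀ hdm (hκm n).aemeasurable]
  simp only [Pi.mul_apply, mul_comm]
  exact le_rfl

theorem lemma3p11 {𝕜 : Type*} [RCLike 𝕜] (N : ℕ) (hN : 1 ≤ N) (w₀ : ℝ → 𝕜)
    (hw₀ : LocallyIntegrableOn w₀ (Ici (0 : ℝ))
      ((volume : Measure ℝ).withDensity (fun t => ENNReal.ofReal (t ^ (N - 1))))) :
    ∀ᵐ T ∂((volume : Measure ℝ).restrict (Ioi (0 : ℝ))),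
      ∀ s R : ℝ, 0 ≤ s → 0 < R → s ^ 2 + R ^ 2 = T ^ 2 →
        ∀ z : (n : ℕ) → EuclideanSpace ℝ (Fin n), (∀ n, N ≤ n → ‖z n‖ = s) →
          (∀ n, N ≤ n →
            IntegrableOn (fun x : EuclideanSpace ℝ (Fin n) => w₀ ‖x‖)
              (Metric.ball (z n) R) volume) ∧
          Tendsto
            (fun n : ℕ => ⨍ x in Metric.ball (z n) R, w₀ ‖x‖ ∂volume)
            atTop (𝓝 (w₀ T)) := by
  have hw : LocallyIntegrable w₀ (powMeasure (N - 1)) :=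
    (locallyIntegrableOn_iff_locallyIntegrable_restrict isClosed_Ici).1 hw₀
  -- The null set is fixed here, before `s`, `R` and the centres are introduced.
  filter_upwards [ae_tendsto_powMeasure_lintegral_enorm_sub_div hw,
    ae_restrict_mem measurableSet_Ioi] with T hleb hT s R hs hR hsRT z hz
  constructor
  · rintro (_ | n) hn
    · omega
    · exact integrableOn_comp_norm_ball (by omega) hw (z (n + 1)) R
  · rw [← tendsto_add_atTop_iff_nat 1]
    refine tendsto_setAverage_comp_norm_ball hw hs hR hT hsRT hleb (z := fun n => z (n + 1)) ?_
    filter_upwards [eventually_ge_atTop N] with n hn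
    exact hz _ (by omega)
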